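/- For a group $G$ let $Z(G)$ be its centre, $G'$ its derived subgroup, and let $\mathrm{Aut}_c(G)$ be the group of central automorphisms of $G$, i.e. of those automorphisms of $G$ that act as the identity on $G/Z(G)$. For groups $H,K$, every endomorphism $\varphi$ of $H\times K$ is identified with the matrix $\begin{pmatrix}\alpha&\beta\\\gamma&\delta\end{pmatrix}$ of its components $\alpha\in\mathrm{End}\,H$, $\beta\in\mathrm{Hom}(K,H)$, $\gamma\in\mathrm{Hom}(H,K)$, $\delta\in\mathrm{End}\,K$, where $\varphi(h,k)=(\alpha(h)\beta(k),\gamma(h)\delta(k))$. The matrices that arise are exactly those with $[\mathrm{im}\,\alpha,\mathrm{im}\,\beta]=1$ and $[\mathrm{im}\,\gamma,\mathrm{im}\,\delta]=1$; they form a monoid $\mathcal{M}_{H,K}$ under row-by-column multiplication (entries are multiplied by composition and added by pointwise product). Put $$\mathcal{Z}_{H,K}=\left\{\begin{pmatrix}\alpha&\beta\\\gamma&\delta\end{pmatrix}:\ \alpha\in\mathrm{Aut}_c(H),\ \beta\in\mathrm{Hom}(K,Z(H)),\ \gamma\in\mathrm{Hom}(H,Z(K)),\ \delta\in\mathrm{Aut}_c(K)\right\}\subseteq\mathcal{M}_{H,K}.$$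 Let $H$ and $K$ be groups satisfying one of the following conditions: (1) $H$ and $K$ are abelian and $H\cong D\oplus B\oplus F$, where $D$ is divisible, $B$ has finite exponent and $F$ is free abelian; (2) $H$ or $K$ is a stem group (a group $G$ is a stem group if $Z(G)\le G'$); (3) both $H$ and $K$ satisfy the maximal and the minimal conditions on normal subgroups. If $H$ and $K$ have no common non-trivial direct factor (that is, no non-trivial direct factor of $H$ is isomorphic to a direct factor of $K$), then $\mathcal{Z}_{H,K}$ is a submonoid of $\mathcal{M}_{H,K}$, and the map sending $\varphi$ to its matrix is an isomorphism $\mathrm{Aut}_c(H\times K)\cong\mathcal{Z}_{H,K}$ (so $\mathcal{Z}_{H,K}$ is a group under matrix multiplication). -/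

import Mathlib

/-- Two-by-two matrices of homomorphisms describing the endomorphisms of `H × K`:
`α ∈ End H`, `β ∈ Hom(K, H)`, `γ ∈ Hom(H, K)`, `δ ∈ End K`, where the images of the two entries
of each row commute elementwise. -/
@[ext]
structure EndMatrix (H : Type*) (K : Type*) [Group H] [Group K] where
  α : H →* H
  β : K →* H
  γ : H →* K
  δ : K →* K
  comm_top : ∀ (h : H) (k : K), Commute (α h) (β k)
  comm_bot : ∀ (h : H) (k : K), Commute (γ h) (δ k)

namespace EndMatrix

variable {H K : Type*} [Group H] [Group K]

/-- The pointwise product ("sum") of two homomorphisms whose values commute. -/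
def homMul {X Y : Type*} [Group X] [Group Y] (f g : X →* Y)
    (hfg : ∀ x y, Commute (f x) (g y)) : X →* Y where
  toFun x := f x * g x
  map_one' := by simp
  map_mul' x y := by
    rw [map_mul, map_mul]
    exact (hfg y x).mul_mul_mul_comm (f x) (g y)

theorem homMul_aux {X Y Z : Type*} [Group X] [Group Y] [Group Z] (f : X →* Z) (g : Y →* Z)
    (hfg : ∀ x y, Commute (f x) (g y)) (a b : X) (c d : Y) :
    f a * g c * (f b * g d) = f (a * b) * g (c * d) := by
  rw [map_mul, map_mul]
  exact (hfg b c).symm.mul_mul_mul_comm (f a) (g d)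

/-- Row-by-column multiplication: products of entries are compositions, sums are pointwise
products in the group. -/
instance : Mul (EndMatrix H K) where
  mul M N :=
    { α := homMul (M.α.comp N.α) (M.β.comp N.γ) fun _ _ => M.comm_top _ _
      β := homMul (M.α.comp N.β) (M.β.comp N.δ) fun _ _ => M.comm_top _ _
      γ := homMul (M.γ.comp N.α) (M.δ.comp N.γ) fun _ _ => M.comm_bot _ _
      δ := homMul (M.γ.comp N.β) (M.δ.comp N.δ) fun _ _ => M.comm_bot _ _
      comm_top := fun h k => by
        change Commute (M.α (N.α h) * M.β (N.γ h)) (M.α (N.β k) * M.β (N.δ k))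
        exact (((N.comm_top h k).map M.α).mul_right (M.comm_top _ _)).mul_left
          ((M.comm_top _ _).symm.mul_right ((N.comm_bot h k).map M.β))
      comm_bot := fun h k => by
        change Commute (M.γ (N.α h) * M.δ (N.γ h)) (M.γ (N.β k) * M.δ (N.δ k))
        exact (((N.comm_top h k).map M.γ).mul_right (M.comm_bot _ _)).mul_left
          ((M.comm_bot _ _).symm.mul_right ((N.comm_bot h k).map M.δ)) }

/-- The identity matrix. -/
instance : One (EndMatrix H K) where
  one :=
    { α := MonoidHom.id H
      β := 1
      γ := 1
      δ := MonoidHom.id K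
      comm_top := fun h _ => Commute.one_right h
      comm_bot := fun _ k => Commute.one_left k }

/-- The matrices form a monoid under row-by-column multiplication. -/
instance : Monoid (EndMatrix H K) where
  mul_assoc L M N := by
    ext x
    · exact homMul_aux L.α L.β L.comm_top _ _ _ _
    · exact homMul_aux L.α L.β L.comm_top _ _ _ _
    · exact homMul_aux L.γ L.δ L.comm_bot _ _ _ _
    · exact homMul_aux L.γ L.δ L.comm_bot _ _ _ _
  one_mul M := by
    ext x
    · exact mul_one _
    · exact mul_one _
    · exact one_mul _
    · exact one_mul _
  mul_one M := by
    ext x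
    · change M.α x * M.β 1 = M.α x
      simp
    · change M.α 1 * M.β x = M.β x
      simp
    · change M.γ x * M.δ 1 = M.γ x
      simp
    · change M.γ 1 * M.δ x = M.δ x
      simp

/-- The matrix of an endomorphism `φ` of `H × K`: its entries are the compositions of `φ` with
the canonical inclusions and projections. -/
def ofEnd (φ : H × K →* H × K) : EndMatrix H K where
  α := (MonoidHom.fst H K).comp (φ.comp (MonoidHom.inl H K))
  β := (MonoidHom.fst H K).comp (φ.comp (MonoidHom.inr H K))
  γ := (MonoidHom.snd H K).comp (φ.comp (MonoidHom.inl H K))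
  δ := (MonoidHom.snd H K).comp (φ.comp (MonoidHom.inr H K))
  comm_top h k :=
    ((MonoidHom.commute_inl_inr h k).map φ).map (MonoidHom.fst H K)
  comm_bot h k :=
    ((MonoidHom.commute_inl_inr h k).map φ).map (MonoidHom.snd H K)

end EndMatrix

/-- The group `Aut_c(G)` of central automorphisms of `G`: the automorphisms acting as the
identity on `G / Z(G)`. -/
def centralAut (G : Type*) [Group G] : Subgroup (MulAut G) where
  carrier := {φ | ∀ g : G, (φ g : G ⧸ Subgroup.center G) = (g : G ⧸ Subgroup.center G)}
  one_mem' _ := rfl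
  mul_mem' {φ ψ} hφ hψ g := (hφ (ψ g)).trans (hψ g)
  inv_mem' {φ} hφ g := by
    have h := hφ (φ⁻¹ g)
    rw [MulAut.apply_inv_self] at h
    exact h.symm

/-- The set `𝒵_{H,K}` of matrices with central automorphisms `α ∈ Aut_c(H)`, `δ ∈ Aut_c(K)` on
the diagonal and homomorphisms `β ∈ Hom(K, Z(H))`, `γ ∈ Hom(H, Z(K))` off the diagonal. -/
def centralMatrices (H K : Type*) [Group H] [Group K] : Set (EndMatrix H K) :=
  {M | (∃ a ∈ centralAut H, a.toMonoidHom = M.α) ∧ M.β.range ≤ Subgroup.center H ∧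
    M.γ.range ≤ Subgroup.center K ∧ ∃ d ∈ centralAut K, d.toMonoidHom = M.δ}

/-- `A` is a direct factor of `G`: `G` is the internal direct product of `A` and some `B`. -/
def IsDirectFactor {G : Type*} [Group G] (A : Subgroup G) : Prop :=
  A.Normal ∧ ∃ B : Subgroup G, B.Normal ∧ IsCompl A B

/-- `H` and `K` have a common non-trivial direct factor (up to isomorphism). -/
def HaveCommonDirectFactor (H K : Type*) [Group H] [Group K] : Prop :=
  ∃ (X : Subgroup H) (Y : Subgroup K),
    IsDirectFactor X ∧ IsDirectFactor Y ∧ X ≠ ⊥ ∧ Nonempty (X ≃* Y)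

/-- `G ≅ D ⊕ B ⊕ F` with `D` divisible, `B` of finite exponent and `F` free abelian
(in multiplicative notation). -/
def IsDivisibleBoundedFree.{u} (G : Type u) [Group G] : Prop :=
  ∃ (D B F : Type u) (_ : CommGroup D) (_ : CommGroup B) (_ : CommGroup F),
    (∀ n : ℕ, n ≠ 0 → ∀ d : D, ∃ x : D, x ^ n = d) ∧
    Monoid.ExponentExists B ∧
    Module.Free ℤ (Additive F) ∧
    Nonempty (G ≃* D × B × F)

/-- A stem group: the centre is contained in the derived subgroup. -/
def IsStemGroup (G : Type*) [Group G] : Prop :=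
  Subgroup.center G ≤ commutator G

/-- The maximal condition on normal subgroups. -/
def MaxN (G : Type*) [Group G] : Prop :=
  WellFoundedGT {N : Subgroup G // N.Normal}

/-- The minimal condition on normal subgroups. -/
def MinN (G : Type*) [Group G] : Prop :=
  WellFoundedLT {N : Subgroup G // N.Normal}

/-! Everything reduces to one claim: for β : K → H and γ : H → K with central values, `1 - βγ`, i.e.
`x ↦ x * (β (γ x))⁻¹`, is bijective on `H`. If M and N are the matrices of a central automorphism
and its inverse, the diagonals of MN = NM = 1 read αα' = 1 - βγ' and α'α = 1 - β'γ, so α is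
bijective, and likewise δ. Conversely, a matrix in 𝒵 is diag(α, δ) times a matrix with identity
diagonal, and eliminating the `K`-variable from the latter leaves `1 - βγ`.

For a stem group the claim holds because homomorphisms with central values kill the derived
subgroup, so βγ is nilpotent. Otherwise the lever is `subsingleton_of_bijective_comp`: a bijective
composite A → H → K → H → C makes A a direct factor of both groups. Under the chain conditions,
Fitting's argument then gives nilpotency. In the abelian case βγ is block triangular on D × B × F:
it is zero into F (else ℤ is a common factor) and zero from D to B, locally nilpotent on B, and has
essential kernel on D. -/

/-! ### Endomorphisms of divisible and of bounded abelian groups. -/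

section AdditiveEndomorphisms

/-- A divisible subgroup is a retract: an injective homomorphism out of a divisible abelian group
has a left inverse. -/
theorem exists_leftInverse_of_divisible {D A : Type*} [AddCommGroup D] [AddCommGroup A]
    (hD : ∀ n : ℕ, n ≠ 0 → ∀ d : D, ∃ x : D, n • x = d) (i : D →+ A)
    (hi : Function.Injective i) : ∃ r : A →+ D, ∀ d, r (i d) = d := by
  let _ : DivisibleBy D ℕ := divisibleByOfSMulRightSurj D ℕ
    fun {n} hn d => hD n hn d
  let _ : DivisibleBy D ℤ := AddGroup.divisibleByIntOfDivisibleByNat D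
  obtain ⟨r, hr⟩ := (Module.Baer.of_divisible D).extension_property_addMonoidHom i hi
    (AddMonoidHom.id D)
  exact ⟨r, fun d => DFunLike.congr_fun hr d⟩

/-- In a divisible abelian group, a subgroup maximal among those meeting `L` trivially is
divisible. -/
theorem divisible_of_maximal_disjoint {D : Type*} [AddCommGroup D]
    (hD : ∀ n : ℕ, n ≠ 0 → ∀ d : D, ∃ x : D, n • x = d) {L N : AddSubgroup D}
    (hN : Maximal (fun M => Disjoint M L) N) :
    ∀ n : ℕ, n ≠ 0 → ∀ d : N, ∃ x : N, n • x = d := by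
  intro n
  induction n using Nat.recOnMul with
  | zero => intro h; exact absurd rfl h
  | one => intro _ d; exact ⟨d, one_smul _ _⟩
  | prime p hp =>
    rintro - ⟨y, hy⟩
    obtain ⟨z, rfl⟩ := hD p hp.ne_zero y
    by_cases hz : z ∈ N
    · exact ⟨⟨z, hz⟩, rfl⟩
    -- Maximality gives `m + k • z ≠ 0` in `L`. It is not in `N`, so `p ∤ k`; its `p`-multiple lies
    -- in `N ∩ L = 0`. Bézout for `k` and `p` then divides `p • z` inside `N`.
    have hnd : ¬ Disjoint (N ⊔ AddSubgroup.zmultiples z) L := fun h =>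
      hz (hN.le_of_ge h le_sup_left
        (AddSubgroup.mem_sup_right (AddSubgroup.mem_zmultiples z)))
    rw [AddSubgroup.disjoint_def] at hnd
    push Not at hnd
    obtain ⟨l, hl, hlL, hl0⟩ := hnd
    obtain ⟨m, hm, w, hw, rfl⟩ := AddSubgroup.mem_sup.mp hl
    obtain ⟨k, rfl⟩ := AddSubgroup.mem_zmultiples_iff.mp hw
    have hdisj : ∀ {x}, x ∈ N → x ∈ L → x = 0 := AddSubgroup.disjoint_def.mp hN.prop
    have hpk : ¬ (p : ℤ) ∣ k := by
      rintro ⟨c, rfl⟩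
      refine hl0 (hdisj (add_mem hm ?_) hlL)
      rw [mul_comm, mul_smul, natCast_zsmul]
      exact zsmul_mem hy c
    have hzero : p • (m + k • z) = 0 := by
      refine hdisj ?_ (nsmul_mem hlL p)
      rw [smul_add, smul_comm]
      exact add_mem (nsmul_mem hm p) (zsmul_mem hy k)
    obtain ⟨a, b, hab⟩ := (Int.isCoprime_iff_gcd_eq_one.mpr
      ((Int.gcd_comm _ _).trans (by
        rw [← Int.isCoprime_iff_gcd_eq_one]
        exact ((Nat.prime_iff_prime_int.mp hp).coprime_iff_not_dvd.mpr hpk))) :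
        IsCoprime k (p : ℤ))
    refine ⟨⟨b • (p • z) - a • m, sub_mem (zsmul_mem hy b) (zsmul_mem hm a)⟩, ?_⟩
    ext
    change p • (b • (p • z) - a • m) = p • z
    have h1 : p • m = -(k • p • z) := by
      rw [smul_add, smul_comm p k z] at hzero
      exact eq_neg_of_add_eq_zero_left hzero
    calc p • (b • (p • z) - a • m) = (b * p) • (p • z) - a • (p • m) := by
          rw [smul_sub, smul_comm p a m, smul_comm p b, mul_smul, natCast_zsmul]
      _ = (a * k + b * p) • (p • z) := by
          rw [h1, add_smul, mul_smul a k, smul_neg]; abel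
      _ = p • z := by rw [hab, one_smul]
  | mul a b ha hb =>
    intro hab d
    obtain ⟨x, rfl⟩ := ha (left_ne_zero_of_mul hab) d
    obtain ⟨y, rfl⟩ := hb (right_ne_zero_of_mul hab) x
    exact ⟨y, mul_smul a b y⟩

/-- Let `f` be an endomorphism of a divisible abelian group `D`. If no non-trivial direct summand
of `D` is mapped injectively onto a retract of `D` by `f`, then `1 - f` is bijective. -/
theorem bijective_sub_of_divisible {D : Type*} [AddCommGroup D]
    (hD : ∀ n : ℕ, n ≠ 0 → ∀ d : D, ∃ x : D, n • x = d) (f : D →+ D)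
    (hf : ∀ (N : AddSubgroup D) (r : D →+ N), (∀ x : N, r (f x) = x) → N = ⊥) :
    Function.Bijective fun x => x - f x := by
  -- The kernel of `f` is essential: a maximal subgroup avoiding it is divisible and embedded by
  -- `f`, so its image splits off.
  have hess : ∀ M : AddSubgroup D, Disjoint M f.ker → M = ⊥ := by
    intro M hM
    obtain ⟨N, hMN, hN⟩ := zorn_le_nonempty₀ {M : AddSubgroup D | Disjoint M f.ker}
      (by
        intro c hc hchain y hy
        refine ⟨sSup c, ?_, fun z hz => le_sSup hz⟩
        rw [Set.mem_ofPred_eq, AddSubgroup.disjoint_def]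
        intro x hx hxf
        obtain ⟨P, hP, hxP⟩ := (AddSubgroup.mem_sSup_of_directedOn ⟨y, hy⟩
          hchain.directedOn).mp hx
        exact AddSubgroup.disjoint_def.mp (hc hP) hxP hxf) M hM
    have hNdiv := divisible_of_maximal_disjoint hD (L := f.ker) (N := N) hN
    obtain ⟨r, hr⟩ := exists_leftInverse_of_divisible hNdiv (f.comp N.subtype) (by
      rw [injective_iff_map_eq_zero]
      intro x hx
      exact Subtype.ext (AddSubgroup.disjoint_def.mp hN.prop x.2 hx))
    exact le_bot_iff.mp (hMN.trans (hf N r hr).le)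
  let e : D →+ D := AddMonoidHom.id D - f
  have he : ∀ x, e x = x - f x := fun x => rfl
  have heinj : Function.Injective e := by
    rw [← AddMonoidHom.ker_eq_bot_iff]
    refine hess _ (AddSubgroup.disjoint_def.mpr fun {x} hx hfx => ?_)
    rw [AddMonoidHom.mem_ker] at hx hfx
    rw [he, hfx, sub_zero] at hx
    exact hx
  -- On `f.ker` the map `e = 1 - f` is the identity, hence so is `g`. Essentiality makes `g`
  -- injective, and therefore `e` surjective.
  obtain ⟨g, hg⟩ := exists_leftInverse_of_divisible hD e heinj
  have hginj : Function.Injective g := by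
    rw [← AddMonoidHom.ker_eq_bot_iff]
    refine hess _ (AddSubgroup.disjoint_def.mpr fun {x} hx hfx => ?_)
    rw [AddMonoidHom.mem_ker] at hx hfx
    have := hg x
    rw [he, hfx, sub_zero, hx] at this
    exact this.symm
  exact ⟨heinj, fun y => ⟨g y, hginj (hg (g y))⟩⟩

/-- Let `f` be an endomorphism of an abelian group `B` of exponent dividing `e ≠ 0`. If no
non-trivial subgroup of `B` is mapped by `f` isomorphically onto a retract of `B`, then `f` is
locally nilpotent. -/
theorem locally_nilpotent_of_bounded {B : Type*} [AddCommGroup B] {e : ℕ} (he : e ≠ 0)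
    (hB : ∀ b : B, e • b = 0) (f : B →+ B)
    (hf : ∀ (A : AddSubgroup B) (C : AddSubgroup (AddCircle (1 : ℚ))) (q : B →+ C),
      (Function.Bijective fun x : A => q (f x)) → A = ⊥) (b : B) :
    ∃ n : ℕ, f^[n] b = 0 := by
  have hmap : ∀ (n m : ℕ) (x : B), f^[n] (m • x) = m • f^[n] x := fun n m x => by
    induction n generalizing x with
    | zero => rfl
    | succ n ih => rw [Function.iterate_succ_apply, Function.iterate_succ_apply, map_nsmul, ih]
  -- On the `p`-socle `f` raises `p`-height. Otherwise a character of `B / p^(k+1) B` detects `f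
  -- (p^k • y)` and maps `f ⟨y⟩` isomorphically onto a cyclic group of order `p^(k+1)`.
  have height : ∀ (p : ℕ), p.Prime → ∀ (k : ℕ) (y : B), p ^ (k + 1) • y = 0 →
      ∃ z, f (p ^ k • y) = p ^ (k + 1) • z := by
    intro p hp k y hy
    by_contra! hcon
    let P : AddSubgroup B := (nsmulAddMonoidHom (α := B) (p ^ (k + 1))).range
    have hP : ((f (p ^ k • y) : B) : B ⧸ P) ≠ 0 := by
      rw [Ne, QuotientAddGroup.eq_zero_iff]
      rintro ⟨z, hz⟩
      exact hcon z hz.symm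
    obtain ⟨c, hc⟩ := CharacterModule.exists_character_apply_ne_zero_of_ne_zero hP
    let χ : B →+ AddCircle (1 : ℚ) := AddMonoidHom.comp c (QuotientAddGroup.mk' P)
    have hχ : ∀ b, p ^ (k + 1) • χ b = 0 := fun b => by
      rw [← map_nsmul]
      have : ((p ^ (k + 1) • b : B) : B ⧸ P) = 0 := (QuotientAddGroup.eq_zero_iff _).mpr ⟨b, rfl⟩
      change c ((p ^ (k + 1) • b : B) : B ⧸ P) = 0
      rw [this, map_zero]
    have hord : addOrderOf (χ (f y)) = p ^ (k + 1) := by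
      have := Fact.mk hp
      refine addOrderOf_eq_prime_pow ?_ (hχ _)
      rw [← map_nsmul, ← map_nsmul]
      exact hc
    have hmpos : 0 < p ^ (k + 1) := pow_pos hp.pos _
    -- The circle has at most `p^(k+1)` elements killed by `p^(k+1)`, so the multiples of `χ (f y)`
    -- exhaust them.
    have hmem : ∀ b, χ b ∈ AddSubgroup.zmultiples (χ (f y)) := by
      have hsub : (AddSubgroup.zmultiples (χ (f y)) : Set (AddCircle (1 : ℚ))) ⊆
          {u : AddCircle (1 : ℚ) | p ^ (k + 1) • u = 0} := by
        rintro _ ⟨j, rfl⟩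
        change p ^ (k + 1) • (j • χ (f y)) = 0
        rw [smul_comm, hχ, smul_zero]
      have hfin : {u : AddCircle (1 : ℚ) | p ^ (k + 1) • u = 0}.Finite :=
        AddCircle.finite_torsion 1 hmpos
      have heq := Set.Finite.eq_of_subset_of_encard_le (hfin.subset hsub) hsub (by
        refine (AddCircle.card_torsion_le_of_isSMulRegular 1 _ hmpos.ne' ?_).trans ?_
        · exact (IsSMulRegular.of_ne_zero (by exact_mod_cast hmpos.ne'))
        · rw [← Set.Finite.cast_ncard_eq (hfin.subset hsub)]
          have := Nat.card_zmultiples (χ (f y))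
          rw [hord] at this
          exact_mod_cast this.ge)
      intro b
      have : χ b ∈ {u : AddCircle (1 : ℚ) | p ^ (k + 1) • u = 0} := hχ b
      rwa [← heq] at this
    have hbot := hf (AddSubgroup.zmultiples y) (AddSubgroup.zmultiples (χ (f y)))
      (χ.codRestrict _ hmem) (by
        constructor
        · rintro ⟨_, i, rfl⟩ ⟨_, j, rfl⟩ h
          have h' : χ (f (i • y)) = χ (f (j • y)) := congrArg Subtype.val h
          rw [map_zsmul, map_zsmul, map_zsmul, map_zsmul, ← sub_eq_zero, ← sub_smul,
            ← addOrderOf_dvd_iff_zsmul_eq_zero, hord] at h'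
          obtain ⟨l, hl⟩ := h'
          refine Subtype.ext ?_
          change i • y = j • y
          rw [← sub_eq_zero, ← sub_smul, hl, mul_comm, mul_smul, natCast_zsmul, hy, smul_zero]
        · rintro ⟨_, j, rfl⟩
          refine ⟨⟨j • y, j, rfl⟩, Subtype.ext ?_⟩
          change χ (f (j • y)) = j • χ (f y)
          rw [map_zsmul, map_zsmul])
    rw [AddSubgroup.zmultiples_eq_bot] at hbot
    exact hcon 0 (by rw [hbot]; simp)
  have socle : ∀ p : ℕ, p.Prime → ∀ x : B, p • x = 0 → f^[e] x = 0 := by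
    intro p hp x hx
    have hdiv : ∀ k, p • f^[k] x = 0 ∧ ∃ z, f^[k] x = p ^ k • z := by
      intro k
      induction k with
      | zero => exact ⟨hx, x, by simp⟩
      | succ k ih =>
        obtain ⟨h1, z, hz⟩ := ih
        rw [Function.iterate_succ_apply']
        refine ⟨by rw [← map_nsmul, h1, map_zero], ?_⟩
        rw [hz]
        exact height p hp k z (by rw [pow_succ', mul_smul, ← hz, h1])
    obtain ⟨h1, z, hz⟩ := hdiv e
    -- Since `a ≤ e`, height `e` is enough: `m` kills `p^e • z`, and so does `p`, which is coprime
    -- to `m`.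
    obtain ⟨a, m, hm, hae⟩ := Nat.exists_eq_pow_mul_and_not_dvd he p hp.ne_one
    have hale : a ≤ e := by
      rw [hae]
      exact (Nat.lt_pow_self hp.one_lt).le.trans (Nat.le_mul_of_pos_right _
        (Nat.pos_of_ne_zero (by rintro rfl; exact hm (dvd_zero p))))
    have h2 : m • f^[e] x = 0 := by
      rw [hz, ← Nat.sub_add_cancel hale, pow_add, ← mul_smul]
      have : m * (p ^ (e - a) * p ^ a) = p ^ (e - a) * e := by rw [hae]; ring_nf
      rw [this, mul_smul, hB, smul_zero]
    have h3 : addOrderOf (f^[e] x) ∣ Nat.gcd m p := Nat.dvd_gcd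
      (addOrderOf_dvd_iff_nsmul_eq_zero.mpr h2) (addOrderOf_dvd_iff_nsmul_eq_zero.mpr h1)
    rw [((Nat.Prime.coprime_iff_not_dvd hp).mpr hm).symm.gcd_eq_one, Nat.dvd_one,
      AddMonoid.addOrderOf_eq_one_iff] at h3
    exact h3
  have key : ∀ m : ℕ, m ≠ 0 → ∀ x : B, m • x = 0 → ∃ n, f^[n] x = 0 := by
    intro m
    induction m using Nat.recOnMul with
    | zero => intro h; exact absurd rfl h
    | one => intro _ x hx; exact ⟨0, by simpa using hx⟩
    | prime p hp => intro _ x hx; exact ⟨e, socle p hp x hx⟩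
    | mul a b ha hb =>
      intro hab x hx
      obtain ⟨n, hn⟩ := ha (left_ne_zero_of_mul hab) (b • x) (by rwa [← mul_smul])
      obtain ⟨n', hn'⟩ := hb (right_ne_zero_of_mul hab) (f^[n] x) (by rw [← hmap, hn])
      exact ⟨n' + n, by rwa [Function.iterate_add_apply]⟩
  exact key e he b (hB b)

end AdditiveEndomorphisms

/-! ### Central homomorphisms, common factors and bijectivity of `1 - βγ`. -/

section CentralPairs

variable {H K : Type*} [Group H] [Group K]

/-- A centrally embedded retract is a direct factor. -/
theorem isDirectFactor_range_of_retract {A : Type*} [Group A] (i : A →* H) (p : H →* A)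
    (hpi : ∀ a, p (i a) = a) (hi : ∀ a, i a ∈ Subgroup.center H) : IsDirectFactor i.range := by
  refine ⟨⟨?_⟩, p.ker, inferInstance, ?_⟩
  · rintro _ ⟨a, rfl⟩ g
    rw [Subgroup.mem_center_iff.mp (hi a) g, mul_inv_cancel_right]
    exact ⟨a, rfl⟩
  · refine IsCompl.of_le ?_ ?_
    · rintro _ ⟨⟨a, rfl⟩, ha⟩
      have : p (i a) = 1 := ha
      rw [hpi] at this
      rw [this, map_one]
      exact one_mem _
    · intro x _
      rw [← mul_inv_cancel_left (i (p x)) x]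
      refine mul_mem (Subgroup.mem_sup_left ⟨_, rfl⟩) (Subgroup.mem_sup_right ?_)
      rw [MonoidHom.mem_ker, map_mul, map_inv, hpi, inv_mul_cancel]

/-- Two groups with a common non-trivial centrally embedded retract have a common non-trivial
direct factor. -/
theorem HaveCommonDirectFactor.of_retracts {A : Type*} [Group A] [Nontrivial A]
    (i : A →* H) (p : H →* A) (hpi : ∀ a, p (i a) = a) (hi : ∀ a, i a ∈ Subgroup.center H)
    (j : A →* K) (q : K →* A) (hqj : ∀ a, q (j a) = a) (hj : ∀ a, j a ∈ Subgroup.center K) :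
    HaveCommonDirectFactor H K := by
  have hi' : Function.Injective i := Function.LeftInverse.injective hpi
  have hj' : Function.Injective j := Function.LeftInverse.injective hqj
  refine ⟨i.range, j.range, isDirectFactor_range_of_retract i p hpi hi,
    isDirectFactor_range_of_retract j q hqj hj, ?_,
    ⟨(MonoidHom.ofInjective hi').symm.trans (MonoidHom.ofInjective hj')⟩⟩
  obtain ⟨a, ha⟩ := exists_ne (1 : A)
  intro h
  exact ha (hi' (((Subgroup.eq_bot_iff_forall _).mp h (i a) ⟨a, rfl⟩).trans (map_one i).symm))

/-- If `H` and `K` have no common non-trivial direct factor, then a composite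
`A → H → K → H → C` in which the maps between `H` and `K` are central can only be bijective if
`A` is trivial. -/
theorem subsingleton_of_bijective_comp (hfac : ¬ HaveCommonDirectFactor H K)
    {β : K →* H} {γ : H →* K} (hβ : ∀ k, β k ∈ Subgroup.center H)
    (hγ : ∀ h, γ h ∈ Subgroup.center K) {A C : Type*} [Group A] [Group C]
    (i : A →* H) (p : H →* C) (hb : Function.Bijective fun a => p (β (γ (i a)))) :
    Subsingleton A := by
  by_contra hA
  rw [not_subsingleton_iff_nontrivial] at hA
  let e : A ≃* C := MulEquiv.ofBijective (p.comp (β.comp (γ.comp i))) hb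
  have he : ∀ a, e.symm (p (β (γ (i a)))) = a := e.symm_apply_apply
  -- `A` embeds in `H` by `βγi` with retraction `e⁻¹p`, and in `K` by `γi` with retraction `e⁻¹pβ`.
  exact hfac (HaveCommonDirectFactor.of_retracts (A := A) (β.comp (γ.comp i))
    (e.symm.toMonoidHom.comp p) he (fun _ => hβ _) (γ.comp i)
    (e.symm.toMonoidHom.comp (p.comp β)) he (fun _ => hγ _))

/-- If `f` is a locally nilpotent endomorphism with central values, then `1 - f` is bijective. -/
theorem bijective_mul_inv_of_locally_nilpotent (f : H →* H)
    (hf : ∀ x, f x ∈ Subgroup.center H) (hn : ∀ x, ∃ n : ℕ, f^[n] x = 1) :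
    Function.Bijective fun x => x * (f x)⁻¹ := by
  constructor
  · intro x y hxy
    have hxy' : x * (f x)⁻¹ = y * (f y)⁻¹ := hxy
    have hfix : f (y⁻¹ * x) = y⁻¹ * x := by
      rw [map_mul, map_inv]
      have h1 : x = y * (f y)⁻¹ * f x := by rw [← hxy', inv_mul_cancel_right]
      nth_rw 2 [h1]
      group
    obtain ⟨n, h⟩ := hn (y⁻¹ * x)
    rw [Function.iterate_fixed hfix, inv_mul_eq_one] at h
    exact h.symm
  · intro y
    -- The witness is the partial geometric series `y * f y * ⋯ * f^[n-1] y`, which telescopes.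
    have partialSum : ∀ n : ℕ, ∃ x, x * (f x)⁻¹ = y * (f^[n] y)⁻¹ := by
      intro n
      induction n with
      | zero => exact ⟨1, by simp⟩
      | succ n ih =>
        obtain ⟨x, hx⟩ := ih
        refine ⟨x * f^[n] y, ?_⟩
        have hc := Subgroup.mem_center_iff.mp (inv_mem (hf x))
        rw [map_mul, mul_inv_rev, ← Function.iterate_succ_apply' f, ← mul_assoc, hc,
          ← mul_assoc, ← mul_assoc, ← hc x, hx, inv_mul_cancel_right]
    obtain ⟨n, h⟩ := hn y
    obtain ⟨x, hx⟩ := partialSum n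
    exact ⟨x, by simpa [h] using hx⟩

/-- If `1 - βγ` is bijective, then so is `1 - γβ`. -/
theorem bijective_mul_inv_comp_swap {β : K →* H} {γ : H →* K}
    (h : Function.Bijective fun x => x * (β (γ x))⁻¹) :
    Function.Bijective fun y => y * (γ (β y))⁻¹ := by
  constructor
  · intro x y hxy
    have hxy' : x * (γ (β x))⁻¹ = y * (γ (β y))⁻¹ := hxy
    have hβ : β x = β y := h.1 (by
      have := congrArg β hxy'
      simpa using this)
    rwa [hβ, mul_left_inj] at hxy'
  · intro y
    -- This is the identity (1 - γβ)⁻¹ = 1 + γ(1 - βγ)⁻¹β.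
    obtain ⟨x, hx⟩ := h.2 (β y)
    have hx' : x * (β (γ x))⁻¹ = β y := hx
    have h2 : β (y * γ x) = x := by rw [map_mul, ← hx', inv_mul_cancel_right]
    exact ⟨y * γ x, by simp only [h2, mul_inv_cancel_right]⟩

/-- Central values commute, so `f` factors through the abelianization. This is how the stem
condition acts. -/
theorem map_eq_one_of_mem_commutator (f : H →* K) (hf : ∀ x, f x ∈ Subgroup.center K) {x : H}
    (hx : x ∈ commutator H) : f x = 1 := by
  have hle : commutator H ≤ f.ker := by
    rw [commutator_def, Subgroup.commutator_le]
    intro a _ b _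
    rw [MonoidHom.mem_ker, map_commutatorElement, commutatorElement_eq_one_iff_mul_comm]
    exact Subgroup.mem_center_iff.mp (hf b) (f a)
  exact hle hx

/-- Fitting's argument: under both chain conditions on normal subgroups, an endomorphism with
central values maps some power of its image bijectively onto itself; if this forces triviality,
the endomorphism is nilpotent. -/
theorem nilpotent_of_chain_conditions (hmax : MaxN H) (hmin : MinN H) (f : H →* H)
    (hf : ∀ x, f x ∈ Subgroup.center H)
    (hX : ∀ (X : Subgroup H) (p : H →* X), (Function.Bijective fun x : X => p (f x)) →
      Subsingleton X) :
    ∃ n : ℕ, ∀ x, f^[n] x = 1 := by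
  let φ : Monoid.End H := f
  let F : ℕ → (H →* H) := fun n => (φ ^ n : Monoid.End H)
  have hF : ∀ n x, F n x = f^[n] x := fun n x => rfl
  have : WellFoundedGT {N : Subgroup H // N.Normal} := hmax
  have : WellFoundedLT {N : Subgroup H // N.Normal} := hmin
  let kerSeq : ℕ →o {N : Subgroup H // N.Normal} :=
    ⟨fun n => ⟨(F n).ker, inferInstance⟩, monotone_nat_of_le_succ fun n x hx => by
      have hx' : f^[n] x = 1 := hx
      change f^[n + 1] x = 1
      rw [Function.iterate_succ_apply', hx', map_one]⟩
  -- The shift by one makes every image in the sequence central, hence normal.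
  let ranSeq : ℕ →o {N : Subgroup H // N.Normal}ᵒᵈ :=
    ⟨fun n => OrderDual.toDual ⟨(F (n + 1)).range, ⟨by
      rintro _ ⟨x, rfl⟩ g
      have hc : F (n + 1) x ∈ Subgroup.center H := by
        rw [hF, Function.iterate_succ_apply']; exact hf _
      rw [Subgroup.mem_center_iff.mp hc g, mul_inv_cancel_right]
      exact ⟨x, rfl⟩⟩⟩, monotone_nat_of_le_succ fun n => by
      rintro _ ⟨x, rfl⟩
      exact ⟨f x, rfl⟩⟩
  obtain ⟨n₁, h₁⟩ := WellFoundedGT.monotone_chain_condition kerSeq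
  obtain ⟨n₂, h₂⟩ := WellFoundedGT.monotone_chain_condition ranSeq
  have hker : ∀ a b, n₁ ≤ a → n₁ ≤ b → (F a).ker = (F b).ker := fun a b ha hb =>
    congrArg Subtype.val ((h₁ a ha).symm.trans (h₁ b hb))
  have hran : ∀ a b, n₂ ≤ a → n₂ ≤ b → (F (a + 1)).range = (F (b + 1)).range := fun a b ha hb =>
    congrArg (fun N => (OrderDual.ofDual N : {N : Subgroup H // N.Normal}).1)
      ((h₂ a ha).symm.trans (h₂ b hb))
  set n := n₁ + n₂ with hn
  -- Past both stabilization points `f` permutes the stable image. Taking `p = f^(n+1)` supplies a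
  -- map from all of `H` to this image with `p ∘ f` bijective on it.
  have hsub := hX (F (n + 1)).range (F (n + 1)).rangeRestrict (by
    constructor
    · let g : (F (n + 1)).range →* (F (n + 1)).range :=
        (F (n + 1)).rangeRestrict.comp (f.comp (F (n + 1)).range.subtype)
      change Function.Injective g
      rw [injective_iff_map_eq_one]
      rintro ⟨_, x, rfl⟩ hx
      have hx' : f^[n + 1] (f (f^[n + 1] x)) = 1 := congrArg Subtype.val hx
      have hmem : x ∈ (F (n + 1 + 1 + (n + 1))).ker := by
        rw [MonoidHom.mem_ker, hF, Function.iterate_add_apply, Function.iterate_succ_apply]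
        exact hx'
      rw [hker _ (n + 1) (by omega) (by omega)] at hmem
      exact Subtype.ext hmem
    · rintro ⟨y, hy⟩
      rw [hran n (n + 1 + (n + 1)) (by omega) (by omega)] at hy
      obtain ⟨x, rfl⟩ := hy
      refine ⟨⟨F (n + 1) x, x, rfl⟩, Subtype.ext ?_⟩
      change f^[n + 1] (f (f^[n + 1] x)) = f^[n + 1 + (n + 1) + 1] x
      exact (Function.iterate_add_apply f (n + 1 + 1) (n + 1) x).symm.trans
        (congrArg (fun m => f^[m] x) (by omega)))
  exact ⟨n + 1, fun x => congrArg Subtype.val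
    (Subsingleton.elim (⟨F (n + 1) x, x, rfl⟩ : (F (n + 1)).range) 1)⟩

end CentralPairs

/-! ### Triangular endomorphisms and maps to ℤ. -/

section Abelian

/-- Bijectivity of `1 - f` on a product of three abelian groups, for `f` upper triangular with
trivial last row. -/
theorem bijective_mul_inv_of_triangular {D B F : Type*} [CommGroup D] [CommGroup B] [CommGroup F]
    (f : D × B × F →* D × B × F) (hF : ∀ x, (f x).2.2 = 1) (hDB : ∀ d, (f (d, 1, 1)).2.1 = 1)
    (hD : Function.Bijective fun d => d * (f (d, 1, 1)).1⁻¹)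
    (hB : Function.Bijective fun b => b * (f (1, b, 1)).2.1⁻¹) :
    Function.Bijective fun x => x * (f x)⁻¹ := by
  have split : ∀ d b x, f (d, b, x) = f (d, 1, 1) * f (1, b, 1) * f (1, 1, x) := fun d b x => by
    rw [← map_mul, ← map_mul]; simp
  constructor
  · let g : D × B × F →* D × B × F := MonoidHom.id _ / f
    have hg : (fun x => x * (f x)⁻¹) = g := funext fun x => (div_eq_mul_inv x (f x)).symm
    rw [hg, injective_iff_map_eq_one]
    rintro ⟨d, b, x⟩ h
    rw [← congrFun hg, mul_inv_eq_one] at h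
    obtain rfl : x = 1 := by rw [← hF (d, b, x), ← h]
    have hs := split d b 1
    rw [← h] at hs
    obtain rfl : b = 1 := hB.1 (by
      have : b = (f (1, b, 1)).2.1 := by
        have := congrArg (fun z => z.2.1) hs
        simpa [hDB, show ((1 : D), (1 : B), (1 : F)) = 1 from rfl] using this
      simp [← this, show ((1 : D), (1 : B), (1 : F)) = 1 from rfl])
    obtain rfl : d = 1 := hD.1 (by
      have : (f (d, 1, 1)).1 = d := by rw [← h]
      simp [this, show ((1 : D), (1 : B), (1 : F)) = 1 from rfl])
    rfl
  · rintro ⟨d, b, x⟩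
    -- Back substitution: the `F`-coordinate stays, then `B` is solved, then `D`.
    obtain ⟨b', hb'⟩ := hB.2 (b * (f (1, 1, x)).2.1)
    obtain ⟨d', hd'⟩ := hD.2 (d * (f (1, b', 1)).1 * (f (1, 1, x)).1)
    refine ⟨(d', b', x), ?_⟩
    simp only [mul_inv_eq_iff_eq_mul] at hb' hd' ⊢
    refine Prod.ext ?_ (Prod.ext ?_ ?_)
    · rw [split]
      simp only [Prod.fst_mul]
      exact hd'.trans (by ac_rfl)
    · rw [split]
      simp only [Prod.snd_mul, Prod.fst_mul, hDB, one_mul]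
      exact hb'.trans (by ac_rfl)
    · simp [hF]

/-- A non-trivial homomorphism to the infinite cyclic group can be rescaled to a surjective one. -/
theorem exists_apply_eq_ofAdd_one {K : Type*} [Group K] (χ : K →* Multiplicative ℤ) {k₀ : K}
    (h : χ k₀ ≠ 1) : ∃ (q : K →* Multiplicative ℤ) (k : K), q k = Multiplicative.ofAdd 1 := by
  -- The image is `aℤ` with `a ≠ 0`; dividing by `a` makes the map surjective.
  obtain ⟨a, ha⟩ := Int.subgroup_cyclic χ.range.toAddSubgroup'
  have hmem : ∀ n : ℤ, (∃ k, χ k = Multiplicative.ofAdd n) ↔ a ∣ n := fun n => by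
    have : n ∈ χ.range.toAddSubgroup' ↔ ∃ k, χ k = Multiplicative.ofAdd n := Iff.rfl
    rw [← this, ha, AddSubgroup.mem_closure_singleton, dvd_iff_exists_eq_mul_left]
    simp [eq_comm]
  have hdvd : ∀ k, a ∣ (χ k).toAdd := fun k => (hmem _).mp ⟨k, rfl⟩
  have ha0 : a ≠ 0 := by
    rintro rfl
    exact h (Multiplicative.toAdd.injective (zero_dvd_iff.mp (hdvd k₀)))
  obtain ⟨k, hk⟩ := (hmem a).mpr dvd_rfl
  refine ⟨{ toFun := fun k => Multiplicative.ofAdd ((χ k).toAdd / a)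
            map_one' := by simp
            map_mul' := fun x y => by
              rw [map_mul, toAdd_mul, Int.add_ediv_of_dvd_left (hdvd x), ofAdd_add] }, k, ?_⟩
  change Multiplicative.ofAdd ((χ k).toAdd / a) = _
  rw [hk, toAdd_ofAdd, Int.ediv_self ha0]

end Abelian

/-! ### The abelian case. -/

section AbelianPairs

variable {H K : Type*} [Group H] [Group K]

theorem apply_zpowersHom_eq_self {G : Type*} [Group G] (q : G →* Multiplicative ℤ) {g : G}
    (hg : q g = Multiplicative.ofAdd 1) (a : Multiplicative ℤ) : q (zpowersHom G g a) = a := by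
  rw [zpowersHom_apply, map_zpow, hg, ← ofAdd_zsmul, smul_eq_mul, mul_one, ofAdd_toAdd]

/-- If `F` is a free abelian direct summand of `H` and `K` is abelian without a common direct
factor with `H`, then every homomorphism `K → F` is trivial. -/
theorem map_eq_one_of_free (hfac : ¬ HaveCommonDirectFactor H K)
    (hH : ∀ h : H, h ∈ Subgroup.center H) (hK : ∀ k : K, k ∈ Subgroup.center K)
    {F : Type*} [CommGroup F] [Module.Free ℤ (Additive F)] (i : F →* H) (p : H →* F)
    (hpi : ∀ x, p (i x) = x) (ψ : K →* F) (k : K) : ψ k = 1 := by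
  by_contra hk
  let b := Module.Free.chooseBasis ℤ (Additive F)
  obtain ⟨t, ht⟩ : ∃ t, b.repr (Additive.ofMul (ψ k)) t ≠ 0 := by
    by_contra! hcon
    exact hk (b.repr.map_eq_zero_iff.mp (Finsupp.ext hcon))
  let c : F →* Multiplicative ℤ := AddMonoidHom.toMultiplicativeRight
    (b.coord t).toAddMonoidHom
  have hc : ∀ x : F, c x = Multiplicative.ofAdd (b.repr (Additive.ofMul x) t) := fun x => rfl
  obtain ⟨q, k₁, hq⟩ := exists_apply_eq_ofAdd_one (c.comp ψ) (k₀ := k) (fun h => ht h)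
  -- ℤ splits off `H` along the basis vector `b t`, and off `K` along `k₁`.
  refine hfac (HaveCommonDirectFactor.of_retracts (A := Multiplicative ℤ)
    (i.comp (zpowersHom F (b t).toMul)) (c.comp p) (fun a => ?_) (fun _ => hH _)
    (zpowersHom K k₁) q (apply_zpowersHom_eq_self q hq) (fun _ => hK _))
  change c (p (i _)) = a
  rw [hpi]
  exact apply_zpowersHom_eq_self c (by rw [hc]; simp) a

theorem bijective_mul_inv_of_divisibleBoundedFree (hfac : ¬ HaveCommonDirectFactor H K)
    (hH : ∀ h : H, h ∈ Subgroup.center H) (hK : ∀ k : K, k ∈ Subgroup.center K)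
    (hDBF : IsDivisibleBoundedFree H) (β : K →* H) (γ : H →* K) :
    Function.Bijective fun x => x * (β (γ x))⁻¹ := by
  obtain ⟨D, B, F, _, _, _, hD, ⟨n, hn, hB⟩, hF, ⟨e⟩⟩ := hDBF
  let f : D × B × F →* D × B × F :=
    e.toMonoidHom.comp (β.comp (γ.comp e.symm.toMonoidHom))
  have hf : ∀ x, f x = e (β (γ (e.symm x))) := fun x => rfl
  suffices h : Function.Bijective fun x => x * (f x)⁻¹ by
    have h2 := (e.symm.bijective.comp h).comp e.bijective
    convert h2 using 2 with x
    simp [hf]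
  let iD : D →* H := e.symm.toMonoidHom.comp (MonoidHom.inl D (B × F))
  let pD : H →* D := (MonoidHom.fst D (B × F)).comp e.toMonoidHom
  let iB : B →* H := e.symm.toMonoidHom.comp ((MonoidHom.inr D (B × F)).comp (MonoidHom.inl B F))
  let pB : H →* B := (MonoidHom.fst B F).comp ((MonoidHom.snd D (B × F)).comp e.toMonoidHom)
  let iF : F →* H := e.symm.toMonoidHom.comp ((MonoidHom.inr D (B × F)).comp (MonoidHom.inr B F))
  let pF : H →* F := (MonoidHom.snd B F).comp ((MonoidHom.snd D (B × F)).comp e.toMonoidHom)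
  have hβ : ∀ k, β k ∈ Subgroup.center H := fun k => hH _
  have hγ : ∀ h, γ h ∈ Subgroup.center K := fun h => hK _
  refine bijective_mul_inv_of_triangular f ?_ ?_ ?_ ?_
  · intro x
    refine map_eq_one_of_free hfac hH hK iF pF (fun x => ?_) (pF.comp β) (γ (e.symm x))
    simp [iF, pF]
  · intro d
    -- Here `n` is an exponent of `B`, so an `n`-th power dies in `B`.
    obtain ⟨d', rfl⟩ := hD n hn.ne' d
    have : ((d' ^ n, 1, 1) : D × B × F) = (d', 1, 1) ^ n := by simp [Prod.pow_mk]
    rw [this, map_pow]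
    exact hB _
  · simp only [← div_eq_mul_inv]
    refine bijective_sub_of_divisible (D := Additive D) hD
      (MonoidHom.toAdditive (pD.comp ((β.comp γ).comp iD))) ?_
    intro N r hr
    let i : Multiplicative N →* H := iD.comp (AddMonoidHom.toMultiplicativeLeft N.subtype)
    let p : H →* Multiplicative N := (AddMonoidHom.toMultiplicativeRight r).comp pD
    have := subsingleton_of_bijective_comp hfac hβ hγ i p (by
      have : (fun a => p (β (γ (i a)))) = id := funext fun a => hr a.toAdd
      rw [this]
      exact Function.bijective_id)
    rw [AddSubgroup.eq_bot_iff_forall]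
    intro x hx
    exact congrArg (fun a : Multiplicative N => (a.toAdd : Additive D))
      (Subsingleton.elim (Multiplicative.ofAdd ⟨x, hx⟩) 1)
  · let g : B →* B := pB.comp ((β.comp γ).comp iB)
    refine bijective_mul_inv_of_locally_nilpotent g
      (fun x => Subgroup.mem_center_iff.mpr fun y => mul_comm _ _) ?_
    refine locally_nilpotent_of_bounded (B := Additive B) hn.ne' hB (MonoidHom.toAdditive g) ?_
    intro A C q hq
    let i : Multiplicative A →* H := iB.comp (AddMonoidHom.toMultiplicativeLeft A.subtype)
    let p : H →* Multiplicative C := (AddMonoidHom.toMultiplicativeRight q).comp pB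
    have := subsingleton_of_bijective_comp hfac hβ hγ i p hq
    rw [AddSubgroup.eq_bot_iff_forall]
    intro x hx
    exact congrArg (fun a : Multiplicative A => (a.toAdd : Additive B))
      (Subsingleton.elim (Multiplicative.ofAdd ⟨x, hx⟩) 1)

end AbelianPairs

/-! ### From `1 - βγ` to central automorphisms. -/

section Main

variable {H K : Type*} [Group H] [Group K]

/-- The only place where the three alternatives are told apart. If `H` is stem, γβ vanishes because
β has values in Z(H) ≤ H', so (βγ)² = 1; if `K` is stem, already βγ = 1. -/
theorem bijective_mul_inv_of_not_common
    (hHK : (IsMulCommutative H ∧ IsMulCommutative K ∧ IsDivisibleBoundedFree H) ∨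
      (IsStemGroup H ∨ IsStemGroup K) ∨
      (MaxN H ∧ MinN H ∧ MaxN K ∧ MinN K))
    (hfac : ¬ HaveCommonDirectFactor H K) (β : K →* H) (γ : H →* K)
    (hβ : ∀ k, β k ∈ Subgroup.center H) (hγ : ∀ h, γ h ∈ Subgroup.center K) :
    Function.Bijective fun x => x * (β (γ x))⁻¹ := by
  obtain ⟨hH, hK, hDBF⟩ | (hH | hK) | ⟨hmax, hmin, -, -⟩ := hHK
  · exact bijective_mul_inv_of_divisibleBoundedFree hfac
      (fun h => Subgroup.mem_center_iff.mpr fun g => hH.is_comm.comm g h)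
      (fun h => Subgroup.mem_center_iff.mpr fun g => hK.is_comm.comm g h) hDBF β γ
  · refine bijective_mul_inv_of_locally_nilpotent (β.comp γ) (fun x => hβ _) fun x => ⟨2, ?_⟩
    change β (γ (β (γ x))) = 1
    rw [map_eq_one_of_mem_commutator γ hγ (hH (hβ _)), map_one]
  · refine bijective_mul_inv_of_locally_nilpotent (β.comp γ) (fun x => hβ _) fun x => ⟨1, ?_⟩
    exact map_eq_one_of_mem_commutator β hβ (hK (hγ _))
  · obtain ⟨n, hn⟩ := nilpotent_of_chain_conditions hmax hmin (β.comp γ) (fun x => hβ _)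
      (fun X p hp => subsingleton_of_bijective_comp hfac hβ hγ X.subtype p hp)
    exact bijective_mul_inv_of_locally_nilpotent (β.comp γ) (fun x => hβ _) fun x => ⟨n, hn x⟩

theorem mem_centralAut_iff {G : Type*} [Group G] {φ : MulAut G} :
    φ ∈ centralAut G ↔ ∀ g, g⁻¹ * φ g ∈ Subgroup.center G :=
  forall_congr' fun _ => eq_comm.trans QuotientGroup.eq

namespace EndMatrix

theorem ofEnd_injective {φ ψ : H × K →* H × K} (h : ofEnd φ = ofEnd ψ) : φ = ψ := by
  have key : ∀ (χ : H × K →* H × K) (x : H × K), χ x =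
      ((ofEnd χ).α x.1 * (ofEnd χ).β x.2, (ofEnd χ).γ x.1 * (ofEnd χ).δ x.2) := fun χ x => by
    have : χ x = χ (x.1, 1) * χ (1, x.2) := by rw [← map_mul]; simp
    rw [this]
    rfl
  exact MonoidHom.ext fun x => by rw [key φ, key ψ, h]

theorem ofEnd_mul (φ ψ : H × K →* H × K) : ofEnd (φ.comp ψ) = ofEnd φ * ofEnd ψ := by
  have key : ∀ x : H × K, φ x = φ (x.1, 1) * φ (1, x.2) := fun x => by rw [← map_mul]; simp
  ext x
  · exact congrArg Prod.fst (key (ψ (x, 1)))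
  · exact congrArg Prod.fst (key (ψ (1, x)))
  · exact congrArg Prod.snd (key (ψ (x, 1)))
  · exact congrArg Prod.snd (key (ψ (1, x)))

/-- The endomorphism of `H × K` with a given matrix. -/
def toEnd (M : EndMatrix H K) : H × K →* H × K where
  toFun x := (M.α x.1 * M.β x.2, M.γ x.1 * M.δ x.2)
  map_one' := by simp
  map_mul' x y := Prod.ext (homMul_aux M.α M.β M.comm_top _ _ _ _).symm
    (homMul_aux M.γ M.δ M.comm_bot _ _ _ _).symm

theorem ofEnd_toEnd (M : EndMatrix H K) : ofEnd M.toEnd = M := by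
  ext x <;> simp [ofEnd, toEnd]

end EndMatrix

theorem mem_center_prod_iff {x : H × K} :
    x ∈ Subgroup.center (H × K) ↔ x.1 ∈ Subgroup.center H ∧ x.2 ∈ Subgroup.center K := by
  simp only [Subgroup.mem_center_iff]
  exact ⟨fun h => ⟨fun g => congrArg Prod.fst (h (g, 1)), fun g => congrArg Prod.snd (h (1, g))⟩,
    fun h g => Prod.ext (h.1 g.1) (h.2 g.2)⟩

theorem symm_apply_mem_center {G : Type*} [Group G] (a : MulAut G) {z : G}
    (hz : z ∈ Subgroup.center G) : a.symm z ∈ Subgroup.center G := by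
  rw [Subgroup.mem_center_iff] at hz ⊢
  intro g
  apply a.injective
  rw [map_mul, map_mul, a.apply_symm_apply]
  exact hz (a g)

/-- If `1 - βγ` is bijective for all central `β : K → H` and `γ : H → K`, the matrix of a central
automorphism of `H × K` has central automorphisms on its diagonal. -/
theorem ofEnd_mem_centralMatrices
    (key : ∀ (β : K →* H) (γ : H →* K), (∀ k, β k ∈ Subgroup.center H) →
      (∀ h, γ h ∈ Subgroup.center K) → Function.Bijective fun x => x * (β (γ x))⁻¹)
    {φ : MulAut (H × K)} (hφ : φ ∈ centralAut (H × K)) :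
    EndMatrix.ofEnd φ.toMonoidHom ∈ centralMatrices H K := by
  have left : ∀ ψ ∈ centralAut (H × K), ∀ h : H,
      h⁻¹ * (ψ (h, 1)).1 ∈ Subgroup.center H ∧ (ψ (h, 1)).2 ∈ Subgroup.center K := by
    intro ψ hψ h
    simpa using mem_center_prod_iff.mp (mem_centralAut_iff.mp hψ (h, 1))
  have right : ∀ ψ ∈ centralAut (H × K), ∀ k : K,
      (ψ (1, k)).1 ∈ Subgroup.center H ∧ k⁻¹ * (ψ (1, k)).2 ∈ Subgroup.center K := by
    intro ψ hψ k
    simpa using mem_center_prod_iff.mp (mem_centralAut_iff.mp hψ (1, k))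
  have hφi := inv_mem hφ
  set M := EndMatrix.ofEnd φ.toMonoidHom with hM
  set N := EndMatrix.ofEnd (φ⁻¹).toMonoidHom with hN
  have hMN : M * N = 1 := by
    rw [hM, hN, ← EndMatrix.ofEnd_mul]
    have : φ.toMonoidHom.comp (φ⁻¹).toMonoidHom = MonoidHom.id _ :=
      MonoidHom.ext fun x => φ.apply_symm_apply x
    rw [this]
    rfl
  have hNM : N * M = 1 := by
    rw [hM, hN, ← EndMatrix.ofEnd_mul]
    have : (φ⁻¹).toMonoidHom.comp φ.toMonoidHom = MonoidHom.id _ :=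
      MonoidHom.ext fun x => φ.symm_apply_apply x
    rw [this]
    rfl
  have hMβ : ∀ k, M.β k ∈ Subgroup.center H := fun k => (right φ hφ k).1
  have hMγ : ∀ h, M.γ h ∈ Subgroup.center K := fun h => (left φ hφ h).2
  have hNβ : ∀ k, N.β k ∈ Subgroup.center H := fun k => (right _ hφi k).1
  have hNγ : ∀ h, N.γ h ∈ Subgroup.center K := fun h => (left _ hφi h).2
  have topMN : ∀ h, M.α (N.α h) = h * (M.β (N.γ h))⁻¹ := fun h =>
    eq_mul_inv_of_mul_eq (DFunLike.congr_fun (congrArg EndMatrix.α hMN) h)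
  have topNM : ∀ h, N.α (M.α h) = h * (N.β (M.γ h))⁻¹ := fun h =>
    eq_mul_inv_of_mul_eq (DFunLike.congr_fun (congrArg EndMatrix.α hNM) h)
  have botMN : ∀ k, M.δ (N.δ k) = k * (M.γ (N.β k))⁻¹ := fun k =>
    eq_mul_inv_of_mul_eq ((M.comm_bot _ _).symm.eq.trans
      (DFunLike.congr_fun (congrArg EndMatrix.δ hMN) k))
  have botNM : ∀ k, N.δ (M.δ k) = k * (N.γ (M.β k))⁻¹ := fun k =>
    eq_mul_inv_of_mul_eq ((N.comm_bot _ _).symm.eq.trans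
      (DFunLike.congr_fun (congrArg EndMatrix.δ hNM) k))
  -- One product of the α-entries gives injectivity, the other surjectivity; for δ the claim is
  -- needed for `1 - γβ`.
  have hα : Function.Bijective M.α := by
    constructor
    · refine Function.Injective.of_comp (f := N.α) ?_
      rw [show N.α ∘ M.α = _ from funext topNM]
      exact (key _ _ hNβ hMγ).1
    · refine Function.Surjective.of_comp (g := N.α) ?_
      rw [show M.α ∘ N.α = _ from funext topMN]
      exact (key _ _ hMβ hNγ).2
  have hδ : Function.Bijective M.δ := by
    constructor
    · refine Function.Injective.of_comp (f := N.δ) ?_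
      rw [show N.δ ∘ M.δ = _ from funext botNM]
      exact (bijective_mul_inv_comp_swap (key _ _ hMβ hNγ)).1
    · refine Function.Surjective.of_comp (g := N.δ) ?_
      rw [show M.δ ∘ N.δ = _ from funext botMN]
      exact (bijective_mul_inv_comp_swap (key _ _ hNβ hMγ)).2
  refine ⟨⟨MulEquiv.ofBijective M.α hα, mem_centralAut_iff.mpr fun h => (left φ hφ h).1, rfl⟩,
    ?_, ?_, ⟨MulEquiv.ofBijective M.δ hδ, mem_centralAut_iff.mpr fun k => (right φ hφ k).2, rfl⟩⟩
  · rintro _ ⟨k, rfl⟩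
    exact hMβ k
  · rintro _ ⟨h, rfl⟩
    exact hMγ h

/-- If `1 - βγ` is bijective for all central `β : K → H` and `γ : H → K`, every matrix in
`centralMatrices H K` is the matrix of a central automorphism of `H × K`. -/
theorem exists_centralAut_of_mem_centralMatrices
    (key : ∀ (β : K →* H) (γ : H →* K), (∀ k, β k ∈ Subgroup.center H) →
      (∀ h, γ h ∈ Subgroup.center K) → Function.Bijective fun x => x * (β (γ x))⁻¹)
    {M : EndMatrix H K} (hM : M ∈ centralMatrices H K) :
    ∃ φ ∈ centralAut (H × K), EndMatrix.ofEnd φ.toMonoidHom = M := by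
  obtain ⟨⟨a, ha, haM⟩, hβ, hγ, d, hd, hdM⟩ := hM
  have haM' : ∀ h, M.α h = a h := fun h => (DFunLike.congr_fun haM h).symm
  have hdM' : ∀ k, M.δ k = d k := fun k => (DFunLike.congr_fun hdM k).symm
  have hβ' : ∀ k, M.β k ∈ Subgroup.center H := fun k => hβ ⟨k, rfl⟩
  have hγ' : ∀ h, M.γ h ∈ Subgroup.center K := fun h => hγ ⟨h, rfl⟩
  -- Dividing by diag(a, d) leaves a matrix with identity diagonal and off-diagonal entries that are
  -- still central.
  let β : K →* H := a.symm.toMonoidHom.comp M.β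
  let γ : H →* K := d.symm.toMonoidHom.comp M.γ
  have haβ : ∀ k, a (β k) = M.β k := fun k => a.apply_symm_apply _
  have hdγ : ∀ h, d (γ h) = M.γ h := fun h => d.apply_symm_apply _
  have hbij := key β γ (fun k => symm_apply_mem_center a (hβ' k))
    (fun h => symm_apply_mem_center d (hγ' h))
  have hto : ∀ x, M.toEnd x = (a (x.1 * β x.2), d (γ x.1 * x.2)) := fun x => by
    rw [map_mul, map_mul, haβ, hdγ, ← haM', ← hdM']
    rfl
  have hMbij : Function.Bijective M.toEnd := by
    constructor
    · rw [injective_iff_map_eq_one]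
      rintro ⟨h, k⟩ hx
      rw [hto, Prod.mk_eq_one, EmbeddingLike.map_eq_one_iff, EmbeddingLike.map_eq_one_iff] at hx
      obtain ⟨h1, h2⟩ := hx
      obtain rfl : k = (γ h)⁻¹ := eq_inv_of_mul_eq_one_right h2
      rw [map_inv] at h1
      obtain rfl : h = 1 := hbij.1 (by simpa using h1)
      simp
    · rintro ⟨x, y⟩
      -- The second coordinate forces `k = (γ h)⁻¹ * d.symm y`; substituting it in the first leaves
      -- this equation for `h`.
      obtain ⟨h, hh⟩ := hbij.2 (a.symm x * (β (d.symm y))⁻¹)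
      refine ⟨(h, (γ h)⁻¹ * d.symm y), ?_⟩
      have hh' : h * (β (γ h))⁻¹ = a.symm x * (β (d.symm y))⁻¹ := hh
      rw [hto]
      simp only [map_mul β, map_inv β, ← mul_assoc, hh', inv_mul_cancel_right, mul_inv_cancel,
        one_mul, MulEquiv.apply_symm_apply]
  refine ⟨MulEquiv.ofBijective M.toEnd hMbij, mem_centralAut_iff.mpr fun x => ?_, M.ofEnd_toEnd⟩
  rw [mem_center_prod_iff]
  have hα := mem_centralAut_iff.mp ha x.1
  have hδ := mem_centralAut_iff.mp hd x.2
  rw [← haM'] at hα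
  rw [← hdM'] at hδ
  constructor
  · change x.1⁻¹ * (M.α x.1 * M.β x.2) ∈ _
    rw [← mul_assoc]
    exact mul_mem hα (hβ' _)
  · change x.2⁻¹ * (M.γ x.1 * M.δ x.2) ∈ _
    rw [(M.comm_bot _ _).eq, ← mul_assoc]
    exact mul_mem hδ (hγ' _)

end Main

theorem corollary5p13 {H K : Type*} [Group H] [Group K]
    (hHK : (IsMulCommutative H ∧ IsMulCommutative K ∧ IsDivisibleBoundedFree H) ∨
      (IsStemGroup H ∨ IsStemGroup K) ∨
      (MaxN H ∧ MinN H ∧ MaxN K ∧ MinN K))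
    (hfac : ¬ HaveCommonDirectFactor H K) :
    ∃ Z : Submonoid (EndMatrix H K), (Z : Set (EndMatrix H K)) = centralMatrices H K ∧
      ∃ e : centralAut (H × K) ≃* Z, ∀ φ : centralAut (H × K),
        (e φ : EndMatrix H K) = EndMatrix.ofEnd (φ : MulAut (H × K)).toMonoidHom := by
  have key := bijective_mul_inv_of_not_common hHK hfac
  let Z : Submonoid (EndMatrix H K) :=
    { carrier := centralMatrices H K
      one_mem' := ofEnd_mem_centralMatrices key (one_mem (centralAut (H × K)))
      -- The diagonal entries of a product are not visibly bijective, so closure is inherited from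
      -- composition of automorphisms.
      mul_mem' := by
        intro M N hM hN
        obtain ⟨φ, hφ, rfl⟩ := exists_centralAut_of_mem_centralMatrices key hM
        obtain ⟨ψ, hψ, rfl⟩ := exists_centralAut_of_mem_centralMatrices key hN
        rw [← EndMatrix.ofEnd_mul]
        exact ofEnd_mem_centralMatrices key (mul_mem hφ hψ) }
  let f : centralAut (H × K) →* Z :=
    { toFun := fun φ => ⟨EndMatrix.ofEnd φ.1.toMonoidHom, ofEnd_mem_centralMatrices key φ.2⟩
      map_one' := rfl
      map_mul' := fun φ ψ =>
        Subtype.ext (EndMatrix.ofEnd_mul φ.1.toMonoidHom ψ.1.toMonoidHom) }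
  refine ⟨Z, rfl, MulEquiv.ofBijective f ⟨?_, ?_⟩, fun φ => rfl⟩
  · intro φ ψ h
    have h' := EndMatrix.ofEnd_injective (congrArg Subtype.val h)
    exact Subtype.ext (MulEquiv.ext fun x => DFunLike.congr_fun h' x)
  · rintro ⟨M, hM⟩
    obtain ⟨φ, hφ, rfl⟩ := exists_centralAut_of_mem_centralMatrices key hM
    exact ⟨⟨φ, hφ⟩, rfl⟩
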